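/- Model. Fix $K$ arms and a known threshold $\mu_0\in\mathbb R$. An instance $\nu=(\nu_a)_{a=1}^K$ consists of reward distributions $\nu_a$ on $\mathbb R$ with means $\mu_a$ such that $R-\mu_a$, $R\sim\nu_a$, is $1$-sub-Gaussian. It is positive if $\max_a\mu_a>\mu_0$ and negative if $\max_a\mu_a<\mu_0$; its set of correct answers is $i^*(\nu)=\{a:\mu_a\ge\mu_0\}$ if it is positive and $i^*(\nu)=\{\mathsf{None}\}$ if it is negative. A 1-identification algorithm consists of a sampling rule that chooses the arm $A_t$ (possibly at random) from the history $H(t-1)=(A_s,X_s)_{s\le t-1}$, after which a reward $X_t\sim\nu_{A_t}$ is observed; a stopping time $\tau\in\mathbb N\cup\{\infty\}$ of the filtration $(\sigma(H(t)))_t$; and a recommendation $\hat a\in[K]\cup\{\mathsf{None}\}$ determined by $H(\tau)$. For $\delta\in(0,1)$ the algorithm is $\delta$-PAC if $\Pr_\nu(\tau<\infty,\ \hat a\in i^*(\nu))>1-\delta$ for every positive and every negative instance $\nu$. Theorem. For every $\delta_0\in(0,\tfrac12)$ there is a constant $c>0$, depending only on $\delta_0$, such that the following holds. Let $K$ be a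 number of arms, $\mu_0\in\mathbb R$, and $\mu_1,\dots,\mu_K\in\mathbb R$ with $\mu_0>\mu_a$ for all $a$, and let $\nu=(N(\mu_a,1))_{a=1}^K$. Then for every $\delta\in(0,\delta_0]$ and every $\delta$-PAC 1-identification algorithm, $$\mathbb E_\nu[\tau]\ \ge\ c\,H_1^{\mathrm{neg}}\,\log\frac1\delta,\qquad H_1^{\mathrm{neg}}=\sum_{a=1}^K\frac{2}{\Delta_{0,a}^2},\quad \Delta_{0,a}=|\mu_0-\mu_a|$$ (where $\mathbb E_\nu[\tau]$ may be $+\infty$). -/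

import Mathlib

open MeasureTheory ProbabilityTheory
open scoped ENNReal

namespace OneIdentification

/-- A bandit instance with `K` arms: the reward law of each arm is a probability distribution
on `ℝ` whose noise (reward minus mean) is `1`-sub-Gaussian. -/
structure Instance (K : ℕ) where
  law : Fin K → Measure ℝ
  isProbabilityMeasure : ∀ a, IsProbabilityMeasure (law a)
  subGaussian : ∀ a, HasSubgaussianMGF (fun x => x - ∫ y, y ∂(law a)) 1 (law a)

/-- The mean reward of arm `a`. -/
noncomputable def Instance.mean {K : ℕ} (ν : Instance K) (a : Fin K) : ℝ :=
  ∫ x, x ∂(ν.law a)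

/-- Positive instances: the largest mean is above the threshold. -/
def Instance.IsPositive {K : ℕ} (ν : Instance K) (μ₀ : ℝ) : Prop :=
  ∃ a, μ₀ < ν.mean a

/-- Negative instances: the largest mean is below the threshold. -/
def Instance.IsNegative {K : ℕ} (ν : Instance K) (μ₀ : ℝ) : Prop :=
  ∀ a, ν.mean a < μ₀

/-- The correct answers (`none` stands for "no qualified arm"): for a positive instance the arms
with mean at least the threshold; for a negative instance only `none`. -/
def Instance.correctAnswers {K : ℕ} (ν : Instance K) (μ₀ : ℝ) : Set (Option (Fin K)) :=
  {o | (ν.IsPositive μ₀ ∧ ∃ a, o = some a ∧ μ₀ ≤ ν.mean a) ∨ (ν.IsNegative μ₀ ∧ o = none)}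

lemma hasSubgaussianMGF_gaussianReal (m : ℝ) :
    HasSubgaussianMGF (fun x => x - ∫ y, y ∂(gaussianReal m 1)) 1 (gaussianReal m 1) := by
  have h : (gaussianReal m 1).map (fun x => x - m) = gaussianReal 0 1 := by
    rw [gaussianReal_map_sub_const, sub_self]
  rw [integral_id_gaussianReal]
  constructor
  · intro t
    have h2 : Integrable (fun x => Real.exp (t * x)) ((gaussianReal m 1).map (fun x => x - m)) := by
      rw [h]
      exact integrable_exp_mul_gaussianReal t
    exact h2.comp_measurable (by fun_prop)
  · intro t
    rw [mgf_gaussianReal h t]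
    simp

/-- The unit-variance Gaussian instance with mean vector `μ`. -/
noncomputable def gaussianInstance {K : ℕ} (μ : Fin K → ℝ) : Instance K where
  law a := gaussianReal (μ a) 1
  isProbabilityMeasure _ := inferInstance
  subGaussian a := hasSubgaussianMGF_gaussianReal (μ a)

/-- Infinite sequences of (action, reward) pairs. The entry with index `n` is the pair
`(A_{n+1}, X_{n+1})` of round `n + 1`. -/
abbrev Path (K : ℕ) : Type := ℕ → Fin K × ℝ

/-- The filtration `t ↦ σ(H(t))`, where `H(t)` is the history of the first `t` rounds. -/
def historyFiltration (K : ℕ) :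
    Filtration ℕ (inferInstance : MeasurableSpace (Path K)) where
  seq t := MeasurableSpace.comap (fun (ω : Path K) (i : Fin t) => ω i) inferInstance
  mono' s t hst := by
    have h : (fun (ω : Path K) (i : Fin s) => ω i) =
        (fun (v : Fin t → Fin K × ℝ) (i : Fin s) => v (Fin.castLE hst i)) ∘
          (fun (ω : Path K) (i : Fin t) => ω i) := rfl
    change MeasurableSpace.comap (fun (ω : Path K) (i : Fin s) => ω i) _ ≤ _
    rw [h, ← MeasurableSpace.comap_comp]
    exact MeasurableSpace.comap_mono (Measurable.comap_le (by fun_prop))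
  le' t := Measurable.comap_le (by fun_prop)

/-- A pulling strategy `(π, τ, â)`. The first arm is drawn from `init` and the arm of round `n + 2`
is drawn from `policy n` given the history of rounds `1, …, n + 1` (Dirac laws and deterministic
kernels give sampling rules that are functions of the history). `τ` is a stopping time of the
history filtration, possibly infinite, and the recommendation is a function of the history up to
time `τ`; its value where `τ = ⊤` plays no role. -/
structure Strategy (K : ℕ) where
  init : Measure (Fin K)
  init_prob : IsProbabilityMeasure init
  policy : (n : ℕ) → Kernel ((_ : Finset.Iic n) → Fin K × ℝ) (Fin K)
  policy_markov : ∀ n, IsMarkovKernel (policy n)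
  τ : Path K → ℕ∞
  isStoppingTime : IsStoppingTime (historyFiltration K) τ
  answer : Path K → Option (Fin K)
  measurable_answer : ∀ o, MeasurableSet[isStoppingTime.measurableSpace] {ω | answer ω = o}

attribute [instance] Instance.isProbabilityMeasure Strategy.init_prob Strategy.policy_markov

/-- The reward of the pulled arm, as a Markov kernel from arms to rewards. -/
noncomputable def Instance.rewardKernel {K : ℕ} (ν : Instance K) : Kernel (Fin K) ℝ :=
  Kernel.ofFunOfCountable ν.law

instance {K : ℕ} (ν : Instance K) : IsMarkovKernel ν.rewardKernel :=
  ⟨fun a => ν.isProbabilityMeasure a⟩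

/-- Law of (action, reward) in round `n + 2` given the history of rounds `1, …, n + 1`. -/
noncomputable def stepKernel {K : ℕ} (alg : Strategy K) (ν : Instance K) (n : ℕ) :
    Kernel ((_ : Finset.Iic n) → Fin K × ℝ) (Fin K × ℝ) :=
  alg.policy n ⊗ₖ Kernel.prodMkLeft _ ν.rewardKernel

instance {K : ℕ} (alg : Strategy K) (ν : Instance K) (n : ℕ) :
    IsMarkovKernel (stepKernel alg ν n) := by
  unfold stepKernel
  infer_instance

/-- The law of the whole interaction of `alg` with the instance `ν` (when the sampling rule is
run forever; only what happens up to time `τ` matters below). -/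
noncomputable def pathMeasure {K : ℕ} (alg : Strategy K) (ν : Instance K) : Measure (Path K) :=
  Kernel.trajMeasure (X := fun _ => Fin K × ℝ) (alg.init ⊗ₘ ν.rewardKernel) (stepKernel alg ν)

/-- `alg` is `δ`-PAC for threshold `μ₀`: on every positive or negative instance it stops and
gives a correct answer with probability larger than `1 - δ`. -/
def IsDeltaPAC {K : ℕ} (μ₀ δ : ℝ) (alg : Strategy K) : Prop :=
  ∀ ν : Instance K, ν.IsPositive μ₀ ∨ ν.IsNegative μ₀ →
    1 - δ < (pathMeasure alg ν).real {ω | alg.τ ω < ⊤ ∧ alg.answer ω ∈ ν.correctAnswers μ₀}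

/-- The expected number of pulls `E_{ν, alg}[τ]`, with value in `[0, ∞]`. -/
noncomputable def expectedPulls {K : ℕ} (alg : Strategy K) (ν : Instance K) : ℝ≥0∞ :=
  ∫⁻ ω, ((alg.τ ω : ℕ∞) : ℝ≥0∞) ∂(pathMeasure alg ν)

/-- `H₁^neg = ∑ₐ 2 / Δ_{0,a}²` with `Δ_{0,a} = |μ₀ - μₐ|`. -/
noncomputable def H1neg {K : ℕ} (μ₀ : ℝ) (μ : Fin K → ℝ) : ℝ :=
  ∑ a, 2 / |μ₀ - μ a| ^ 2

end OneIdentification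

/-!
The proof is a change-of-measure argument, one arm at a time. Fix an arm `a` with gap
`Δ = μ₀ - μ a` and move its mean to `μ₀ + Δ`. The original instance is negative and the new one is
positive, so the event that the algorithm has stopped with answer `none` has probability larger than
`1 - δ` under the first and at most `δ` under the second. Telling the two instances apart this well
costs relative entropy at least `(1 - 2δ) log ((1 - δ) / δ)`, and each pull of arm `a` contributes
only `(2Δ)² / 2`. Hence the expected number of pulls of `a` is at least
`(1 - 2δ) log ((1 - δ) / δ) / (2Δ²)`. Summing over the arms, and bounding the relative entropy below
by a multiple of `log (1 / δ)` that depends only on `δ₀` (`mul_log_one_div_le`), gives the theorem.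
Moving the mean by `2Δ` rather than by slightly more than `Δ` only costs a factor `4` in the
constant.

No general theory of relative entropy is used, and everything is truncated at a fixed horizon `n`,
chosen so that the probability of having answered `none` by round `n` still exceeds `1 - δ`. The
likelihood ratio of the two path laws on `σ(H(t))` is a product over rounds
(`lintegral_history_eq_lintegral_mul_prod`), because the sampling rule is common to both instances;
splitting according to the value of `τ` extends this to the likelihood ratio up to `min n τ`
(`measure_inter_le_eq_setLIntegral_stoppedProd`). Integrating `exp x ≥ 1 + x`, with `x` the
log-likelihood ratio plus a suitable two-valued function, bounds the expected log-likelihood ratio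
(`add_integral_stoppedSum_le`), which Wald's identity (`integral_stoppedSum_shiftLogRatio`)
expresses through the expected number of pulls of `a`.
-/

namespace OneIdentification

variable {K : ℕ}

/-! ### The law of one round given the history -/

/-- The history of the first `t` rounds, as a tuple indexed by `Fin t`. -/
def history (t : ℕ) (ω : Path K) : Fin t → Fin K × ℝ := fun i => ω i

@[fun_prop]
lemma measurable_history (t : ℕ) : Measurable (history (K := K) t) := by
  unfold history
  fun_prop

lemma history_succ (t : ℕ) (ω : Path K) :
    history (t + 1) ω = Fin.snoc (α := fun _ => Fin K × ℝ) (history t ω) (ω t) := by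
  ext i : 1
  refine Fin.lastCases ?_ (fun j => ?_) i
  · simp [history]
  · simp [history]

/-- The law of the arm pulled in round `t + 1` given the history of the first `t` rounds. It merges
the initial law and the policies of a strategy into one family indexed by `t`. -/
noncomputable def actionKernel (alg : Strategy K) :
    (t : ℕ) → Kernel (Fin t → Fin K × ℝ) (Fin K)
  | 0 => Kernel.const _ alg.init
  | n + 1 => (alg.policy n).comap
      (fun v i => v ⟨i, Nat.lt_succ_of_le (Finset.mem_Iic.1 i.2)⟩) (by fun_prop)

instance (alg : Strategy K) (t : ℕ) : IsMarkovKernel (actionKernel alg t) := by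
  cases t <;> unfold actionKernel <;> infer_instance

/-- The joint law of arm and reward in round `t + 1` given the history of the first `t` rounds. -/
noncomputable def roundKernel (alg : Strategy K) (ν : Instance K) (t : ℕ) :
    Kernel (Fin t → Fin K × ℝ) (Fin K × ℝ) :=
  actionKernel alg t ⊗ₖ Kernel.prodMkLeft _ ν.rewardKernel

instance (alg : Strategy K) (ν : Instance K) (t : ℕ) : IsMarkovKernel (roundKernel alg ν t) := by
  unfold roundKernel
  infer_instance

instance (alg : Strategy K) (ν : Instance K) : IsProbabilityMeasure (pathMeasure alg ν) := by
  unfold pathMeasure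
  infer_instance

lemma pathMeasure_map_zero (alg : Strategy K) (ν : Instance K) :
    (pathMeasure alg ν).map (fun ω => ω 0) = alg.init ⊗ₘ ν.rewardKernel := by
  have h : (fun ω : Path K => ω 0) =
      (MeasurableEquiv.piUnique (fun _ : Finset.Iic 0 => Fin K × ℝ)) ∘
        Preorder.frestrictLe (π := fun _ => Fin K × ℝ) 0 := rfl
  rw [h, ← Measure.map_map (by fun_prop) (by fun_prop), pathMeasure, Kernel.trajMeasure,
    Measure.map_comp _ _ (by fun_prop), Kernel.traj_map_frestrictLe, Kernel.partialTraj_self,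
    Measure.id_comp]
  exact MeasurableEquiv.map_map_symm _

/-- The law of the history together with the next round disintegrates along `roundKernel`. -/
lemma pathMeasure_map_history_prod (alg : Strategy K) (ν : Instance K) (t : ℕ) :
    (pathMeasure alg ν).map (fun ω => (history t ω, ω t)) =
      (pathMeasure alg ν).map (history t) ⊗ₘ roundKernel alg ν t := by
  ext s hs
  rw [Measure.map_apply (by fun_prop) hs, Measure.compProd_apply hs,
    lintegral_map (Kernel.measurable_kernel_prodMk_left hs) (by fun_prop)]
  cases t with
  | zero =>
    have hconst : ∀ ω : Path K, history 0 ω = Fin.elim0 := fun ω => Subsingleton.elim _ _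
    have hround : roundKernel alg ν 0 Fin.elim0 = (pathMeasure alg ν).map (fun ω => ω 0) := by
      rw [pathMeasure_map_zero]
      ext u hu
      rw [roundKernel, Kernel.compProd_apply hu, Measure.compProd_apply hu]
      rfl
    simp only [hconst, lintegral_const, measure_univ, mul_one, hround]
    rw [Measure.map_apply (by fun_prop) (measurable_prodMk_left hs)]
    rfl
  | succ n =>
    have h := Kernel.map_frestrictLe_trajMeasure_compProd_eq_map_trajMeasure
      (X := fun _ => Fin K × ℝ) (μ₀ := alg.init ⊗ₘ ν.rewardKernel) (κ := stepKernel alg ν) (a := n)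
    set e : ((_ : Finset.Iic n) → Fin K × ℝ) → (Fin (n + 1) → Fin K × ℝ) :=
      fun u i => u ⟨i, Finset.mem_Iic.2 (Nat.le_of_lt_succ i.2)⟩
    have hem : Measurable e := by fun_prop
    have hs' : MeasurableSet (Prod.map e (id : Fin K × ℝ → Fin K × ℝ) ⁻¹' s) :=
      (hem.prodMap measurable_id) hs
    have h' := congrArg (fun m => m (Prod.map e (id : Fin K × ℝ → Fin K × ℝ) ⁻¹' s)) h
    rw [Measure.compProd_apply hs', Measure.map_apply (by fun_prop) hs',
      lintegral_map (Kernel.measurable_kernel_prodMk_left hs') (by fun_prop)] at h'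
    have hround : ∀ ω : Path K, roundKernel alg ν (n + 1) (history (n + 1) ω) =
        stepKernel alg ν n (Preorder.frestrictLe (π := fun _ => Fin K × ℝ) n ω) := by
      intro ω
      ext u hu
      rw [roundKernel, stepKernel, Kernel.compProd_apply hu, Kernel.compProd_apply hu]
      rfl
    simp only [hround]
    exact h'.symm

lemma lintegral_history_prod (alg : Strategy K) (ν : Instance K) (t : ℕ)
    {f : (Fin t → Fin K × ℝ) × (Fin K × ℝ) → ℝ≥0∞} (hf : Measurable f) :
    ∫⁻ ω, f (history t ω, ω t) ∂(pathMeasure alg ν) =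
      ∫⁻ ω, ∫⁻ y, f (history t ω, y) ∂(roundKernel alg ν t (history t ω)) ∂(pathMeasure alg ν) := by
  have h := congrArg (fun m => ∫⁻ z, f z ∂m) (pathMeasure_map_history_prod alg ν t)
  rw [lintegral_map hf (by fun_prop), Measure.lintegral_compProd hf,
    lintegral_map (Measurable.lintegral_kernel_prod_right' hf) (by fun_prop)] at h
  exact h

lemma lintegral_roundKernel (alg : Strategy K) (ν : Instance K) (t : ℕ)
    (v : Fin t → Fin K × ℝ) {f : Fin K × ℝ → ℝ≥0∞} (hf : Measurable f) :
    ∫⁻ y, f y ∂(roundKernel alg ν t v) =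
      ∫⁻ b, ∫⁻ x, f (b, x) ∂(ν.law b) ∂(actionKernel alg t v) := by
  rw [roundKernel, Kernel.lintegral_compProd _ _ _ hf]
  rfl

lemma measurableSet_historyFiltration_iff {t : ℕ} {A : Set (Path K)} :
    MeasurableSet[historyFiltration K t] A ↔
      ∃ B : Set (Fin t → Fin K × ℝ), MeasurableSet B ∧ history t ⁻¹' B = A := Iff.rfl

/-! ### Change of measure -/

/-- If the reward laws of `ν'` have densities `r` with respect to those of `ν`, then the product of
the `r (A_s, X_s)` over the first `t` rounds is the likelihood ratio of the two path laws on
`σ(H(t))`: the laws of the arms given the past are common to both and cancel. -/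
lemma lintegral_history_eq_lintegral_mul_prod (alg : Strategy K) {ν ν' : Instance K}
    {r : Fin K × ℝ → ℝ≥0∞} (hr : Measurable r)
    (hν : ∀ b, ν'.law b = (ν.law b).withDensity (fun x => r (b, x)))
    (t : ℕ) {f : (Fin t → Fin K × ℝ) → ℝ≥0∞} (hf : Measurable f) :
    ∫⁻ ω, f (history t ω) ∂(pathMeasure alg ν') =
      ∫⁻ ω, f (history t ω) * ∏ i ∈ Finset.range t, r (ω i) ∂(pathMeasure alg ν) := by
  induction t with
  | zero =>
    have h : ∀ ω : Path K, f (history 0 ω) = f Fin.elim0 := fun ω =>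
      congrArg f (Subsingleton.elim _ _)
    simp [h]
  | succ t ih =>
    have hsnoc : Measurable (fun z : (Fin t → Fin K × ℝ) × (Fin K × ℝ) =>
        (Fin.snoc (α := fun _ => Fin K × ℝ) z.1 z.2 : Fin (t + 1) → Fin K × ℝ)) := by
      refine measurable_pi_lambda _ fun i => ?_
      refine Fin.lastCases ?_ (fun j => ?_) i
      · simpa using measurable_snd
      · simpa [Function.comp_def] using (measurable_pi_apply j).comp measurable_fst
    have hg : Measurable (fun z : (Fin t → Fin K × ℝ) × (Fin K × ℝ) =>
        f (Fin.snoc (α := fun _ => Fin K × ℝ) z.1 z.2)) := hf.comp hsnoc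
    have hprod : ∀ ω : Path K, ∏ i ∈ Finset.range t, r (ω i) = ∏ i, r (history t ω i) := fun ω =>
      (Fin.prod_univ_eq_prod_range (fun i => r (ω i)) t).symm
    have hround : ∀ v : Fin t → Fin K × ℝ, ∀ g : Fin K × ℝ → ℝ≥0∞, Measurable g →
        ∫⁻ y, g y ∂(roundKernel alg ν' t v) = ∫⁻ y, g y * r y ∂(roundKernel alg ν t v) := by
      intro v g hg
      rw [lintegral_roundKernel _ _ _ _ hg, 
        lintegral_roundKernel alg ν t v (f := fun y => g y * r y) (hg.mul hr)]
      refine lintegral_congr fun b => ?_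
      rw [hν b, lintegral_withDensity_eq_lintegral_mul _ (by fun_prop) (by fun_prop)]
      simp [mul_comm]
    simp only [history_succ, Finset.prod_range_succ]
    rw [lintegral_history_prod alg ν' t hg]
    have h1 := fun ω : Path K =>
      hround (history t ω) _ (hg.comp (measurable_prodMk_left (x := history t ω)))
    simp only [Function.comp_apply] at h1
    simp only [h1]
    have hgr : Measurable (fun v => ∫⁻ y, f (Fin.snoc (α := fun _ => Fin K × ℝ) v y) * r y
        ∂(roundKernel alg ν t v)) :=
      Measurable.lintegral_kernel_prod_right' (f := fun z : (Fin t → Fin K × ℝ) × (Fin K × ℝ) =>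
        f (Fin.snoc (α := fun _ => Fin K × ℝ) z.1 z.2) * r z.2) (by fun_prop)
    rw [ih hgr]
    simp only [hprod]
    have h2 := lintegral_history_prod alg ν t
      (f := fun z => f (Fin.snoc (α := fun _ => Fin K × ℝ) z.1 z.2) *
        ((∏ i, r (z.1 i)) * r z.2)) (by fun_prop)
    simp only at h2
    rw [h2]
    refine lintegral_congr fun ω => ?_
    rw [← lintegral_mul_const _ (by fun_prop)]
    refine lintegral_congr fun y => ?_
    ring

lemma measure_eq_setLIntegral_prod (alg : Strategy K) {ν ν' : Instance K}
    {r : Fin K × ℝ → ℝ≥0∞} (hr : Measurable r)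
    (hν : ∀ b, ν'.law b = (ν.law b).withDensity (fun x => r (b, x)))
    {t : ℕ} {A : Set (Path K)} (hA : MeasurableSet[historyFiltration K t] A) :
    pathMeasure alg ν' A = ∫⁻ ω in A, ∏ i ∈ Finset.range t, r (ω i) ∂(pathMeasure alg ν) := by
  obtain ⟨B, hB, rfl⟩ := measurableSet_historyFiltration_iff.1 hA
  have hA' : MeasurableSet (history (K := K) t ⁻¹' B) := measurable_history t hB
  have h := lintegral_history_eq_lintegral_mul_prod alg hr hν t
    (f := B.indicator 1) (measurable_one.indicator hB)
  have h1 : (fun ω : Path K => B.indicator (1 : (Fin t → Fin K × ℝ) → ℝ≥0∞) (history t ω)) =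
      (history t ⁻¹' B).indicator 1 := rfl
  rw [h1, lintegral_indicator_one hA'] at h
  rw [h, ← lintegral_indicator hA']
  refine lintegral_congr fun ω => ?_
  by_cases hω : history t ω ∈ B
  · rw [Set.indicator_of_mem hω, Set.indicator_of_mem (Set.mem_preimage.2 hω)]
    simp
  · rw [Set.indicator_of_notMem hω, Set.indicator_of_notMem (by simpa using hω)]
    simp

lemma measurableSet_of_history {t : ℕ} {A : Set (Path K)}
    (hA : MeasurableSet[historyFiltration K t] A) : MeasurableSet A :=
  (historyFiltration K).le t A hA

lemma Strategy.measurableSet_inter_le (alg : Strategy K) {A : Set (Path K)}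
    (hA : MeasurableSet[alg.isStoppingTime.measurableSpace] A) (n : ℕ) :
    MeasurableSet[historyFiltration K n] (A ∩ {ω | alg.τ ω ≤ n}) :=
  ((alg.isStoppingTime.measurableSet A).1 hA).2 n

lemma Strategy.measurableSet_lt_τ (alg : Strategy K) (n : ℕ) :
    MeasurableSet[historyFiltration K n] {ω | (n : ℕ∞) < alg.τ ω} :=
  alg.isStoppingTime.measurableSet_gt n

/-- The product of the likelihood ratios of the rounds `1, …, min n τ`. -/
noncomputable def stoppedProd (alg : Strategy K) (r : Fin K × ℝ → ℝ≥0∞) (n : ℕ) (ω : Path K) :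
    ℝ≥0∞ :=
  ∏ i ∈ Finset.range n, if (i : ℕ∞) < alg.τ ω then r (ω i) else 1

lemma stoppedProd_eq_prod_of_le (alg : Strategy K) (r : Fin K × ℝ → ℝ≥0∞) {n : ℕ} {ω : Path K}
    (h : (n : ℕ∞) ≤ alg.τ ω) : stoppedProd alg r n ω = ∏ i ∈ Finset.range n, r (ω i) := by
  refine Finset.prod_congr rfl fun i hi => if_pos (lt_of_lt_of_le ?_ h)
  exact_mod_cast Finset.mem_range.1 hi

lemma stoppedProd_succ_of_le (alg : Strategy K) (r : Fin K × ℝ → ℝ≥0∞) {n : ℕ} {ω : Path K}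
    (h : alg.τ ω ≤ n) : stoppedProd alg r (n + 1) ω = stoppedProd alg r n ω := by
  rw [stoppedProd, Finset.prod_range_succ, if_neg (not_lt.2 h), mul_one, stoppedProd]

/-- Change of measure up to the stopping time: an event of the past of `τ` is split according to
the value of `τ`, and on each piece the likelihood ratio at that fixed time applies. -/
lemma measure_inter_le_eq_setLIntegral_stoppedProd (alg : Strategy K) {ν ν' : Instance K}
    {r : Fin K × ℝ → ℝ≥0∞} (hr : Measurable r)
    (hν : ∀ b, ν'.law b = (ν.law b).withDensity (fun x => r (b, x)))
    {A : Set (Path K)} (hA : MeasurableSet[alg.isStoppingTime.measurableSpace] A) (n : ℕ) :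
    pathMeasure alg ν' (A ∩ {ω | alg.τ ω ≤ n}) =
      ∫⁻ ω in A ∩ {ω | alg.τ ω ≤ n}, stoppedProd alg r n ω ∂(pathMeasure alg ν) := by
  induction n with
  | zero =>
    rw [measure_eq_setLIntegral_prod alg hr hν (alg.measurableSet_inter_le hA 0)]
    simp [stoppedProd]
  | succ n ih =>
    have hsplit : A ∩ {ω | alg.τ ω ≤ (n + 1 : ℕ)} =
        (A ∩ {ω | alg.τ ω ≤ n}) ∪
          (A ∩ {ω | alg.τ ω ≤ (n + 1 : ℕ)}) ∩ {ω | (n : ℕ∞) < alg.τ ω} := by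
      ext ω
      simp only [Set.mem_inter_iff, Set.mem_union, Set.mem_ofPred_eq]
      have h1 : alg.τ ω ≤ n → alg.τ ω ≤ (n + 1 : ℕ) := fun h =>
        h.trans (by exact_mod_cast n.le_succ)
      have h2 := le_or_gt (alg.τ ω) n
      tauto
    have hdisj : Disjoint (A ∩ {ω | alg.τ ω ≤ n})
        ((A ∩ {ω | alg.τ ω ≤ (n + 1 : ℕ)}) ∩ {ω | (n : ℕ∞) < alg.τ ω}) :=
      Set.disjoint_left.2 fun ω h1 h2 => (not_lt.2 h1.2 : ¬(n : ℕ∞) < alg.τ ω) h2.2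
    have hm : MeasurableSet[historyFiltration K (n + 1)]
        ((A ∩ {ω | alg.τ ω ≤ (n + 1 : ℕ)}) ∩ {ω | (n : ℕ∞) < alg.τ ω}) :=
      MeasurableSet.inter (alg.measurableSet_inter_le hA (n + 1))
        ((historyFiltration K).mono n.le_succ _ (alg.measurableSet_lt_τ n))
    have hm1 := measurableSet_of_history hm
    have hm0 := measurableSet_of_history (alg.measurableSet_inter_le hA n)
    rw [hsplit, measure_union hdisj hm1, lintegral_union hm1 hdisj, ih,
      measure_eq_setLIntegral_prod alg hr hν hm]
    congr 1
    · exact setLIntegral_congr_fun hm0 fun ω hω => (stoppedProd_succ_of_le alg r hω.2).symm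
    · refine setLIntegral_congr_fun hm1 fun ω hω =>
        (stoppedProd_eq_prod_of_le alg r ?_).symm
      have h3 : (n : ℕ∞) < alg.τ ω := hω.2
      push_cast
      exact Order.add_one_le_of_lt h3

lemma lintegral_stoppedProd (alg : Strategy K) {ν ν' : Instance K}
    {r : Fin K × ℝ → ℝ≥0∞} (hr : Measurable r)
    (hν : ∀ b, ν'.law b = (ν.law b).withDensity (fun x => r (b, x))) (n : ℕ) :
    ∫⁻ ω, stoppedProd alg r n ω ∂(pathMeasure alg ν) = 1 := by
  have hm := measurableSet_of_history (alg.isStoppingTime n)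
  have hc : {ω | alg.τ ω ≤ n}ᶜ = {ω | (n : ℕ∞) < alg.τ ω} := by
    ext ω
    simp
  have h1 := measure_inter_le_eq_setLIntegral_stoppedProd alg hr hν
    (A := Set.univ) MeasurableSet.univ n
  have h2 := measure_eq_setLIntegral_prod alg hr hν (alg.measurableSet_lt_τ n)
  rw [Set.univ_inter] at h1
  rw [← lintegral_add_compl _ hm]
  have h3 : ∫⁻ ω in {ω | alg.τ ω ≤ n}ᶜ, stoppedProd alg r n ω ∂(pathMeasure alg ν) =
      pathMeasure alg ν' {ω | alg.τ ω ≤ n}ᶜ := by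
    rw [hc, h2]
    exact setLIntegral_congr_fun (measurableSet_of_history (alg.measurableSet_lt_τ n))
      fun ω hω => stoppedProd_eq_prod_of_le alg r (le_of_lt hω)
  refine (congrArg₂ (· + ·) h1.symm h3).trans ?_
  exact (measure_add_measure_compl hm).trans measure_univ

/-! ### Comparison of two instances up to the stopping time -/

/-- The log-likelihood ratio of the rounds `1, …, min n τ`, where `l` is that of one round. -/
noncomputable def stoppedSum (alg : Strategy K) (l : Fin K × ℝ → ℝ) (n : ℕ) (ω : Path K) : ℝ :=
  ∑ i ∈ Finset.range n, {ω | (i : ℕ∞) < alg.τ ω}.indicator (fun ω => l (ω i)) ω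

lemma stoppedProd_exp (alg : Strategy K) (l : Fin K × ℝ → ℝ) (n : ℕ) (ω : Path K) :
    stoppedProd alg (fun y => ENNReal.ofReal (Real.exp (l y))) n ω =
      ENNReal.ofReal (Real.exp (stoppedSum alg l n ω)) := by
  rw [stoppedProd, stoppedSum, Real.exp_sum, ENNReal.ofReal_prod_of_nonneg
    fun _ _ => (Real.exp_pos _).le]
  refine Finset.prod_congr rfl fun i _ => ?_
  by_cases h : (i : ℕ∞) < alg.τ ω <;> simp [Set.indicator, h]

/-- A two-point Donsker-Varadhan inequality for the stopped histories: `exp x ≥ 1 + x` is integrated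
with `x` the log-likelihood ratio plus a function taking the value `u` on the event
`A ∩ {τ ≤ n}` and `w` off it. -/
lemma add_integral_stoppedSum_le (alg : Strategy K) {ν ν' : Instance K}
    {l : Fin K × ℝ → ℝ} (hl : Measurable l)
    (hν : ∀ b, ν'.law b = (ν.law b).withDensity (fun x => ENNReal.ofReal (Real.exp (l (b, x)))))
    {A : Set (Path K)} (hA : MeasurableSet[alg.isStoppingTime.measurableSpace] A) (n : ℕ)
    (hint : Integrable (stoppedSum alg l n) (pathMeasure alg ν)) (u w : ℝ) :
    (pathMeasure alg ν).real (A ∩ {ω | alg.τ ω ≤ n}) * u +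
        (1 - (pathMeasure alg ν).real (A ∩ {ω | alg.τ ω ≤ n})) * w +
        ∫ ω, stoppedSum alg l n ω ∂(pathMeasure alg ν) + 1 ≤
      (pathMeasure alg ν').real (A ∩ {ω | alg.τ ω ≤ n}) * Real.exp u +
        (1 - (pathMeasure alg ν').real (A ∩ {ω | alg.τ ω ≤ n})) * Real.exp w := by
  set p := pathMeasure alg ν
  set q := pathMeasure alg ν'
  set B := A ∩ {ω | alg.τ ω ≤ n}
  have hB : MeasurableSet B := measurableSet_of_history (alg.measurableSet_inter_le hA n)
  have hr : Measurable (fun y => ENNReal.ofReal (Real.exp (l y))) := by fun_prop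
  have hq : q B = ∫⁻ ω in B, ENNReal.ofReal (Real.exp (stoppedSum alg l n ω)) ∂p := by
    simp only [← stoppedProd_exp]
    exact measure_inter_le_eq_setLIntegral_stoppedProd alg hr hν hA n
  have hone : ∫⁻ ω, ENNReal.ofReal (Real.exp (stoppedSum alg l n ω)) ∂p = 1 := by
    simp only [← stoppedProd_exp]
    exact lintegral_stoppedProd alg hr hν n
  set Z : Path K → ℝ := fun ω => Real.exp (stoppedSum alg l n ω) with hZ
  have hZm : AEStronglyMeasurable Z p :=
    Real.continuous_exp.comp_aestronglyMeasurable hint.aestronglyMeasurable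
  have hZnn : 0 ≤ Z := fun ω => (Real.exp_pos _).le
  have hZint : Integrable Z p := by
    refine ⟨hZm, ?_⟩
    rw [hasFiniteIntegral_iff_ofReal (ae_of_all _ hZnn), hone]
    exact ENNReal.one_lt_top
  have hZB : ∫ ω in B, Z ω ∂p = q.real B := by
    rw [integral_eq_lintegral_of_nonneg_ae (ae_of_all _ hZnn) hZm.restrict, ← hq, Measure.real]
  have hZ1 : ∫ ω, Z ω ∂p = 1 := by
    rw [integral_eq_lintegral_of_nonneg_ae (ae_of_all _ hZnn) hZm, hone, ENNReal.toReal_one]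
  have hZBc : ∫ ω in Bᶜ, Z ω ∂p = 1 - q.real B := by
    rw [← hZB, ← hZ1, ← integral_add_compl hB hZint]
    ring
  have hexp : ∀ (S : Set (Path K)) (c : ℝ),
      p.real S * (c + 1) + ∫ ω in S, stoppedSum alg l n ω ∂p ≤ Real.exp c * ∫ ω in S, Z ω ∂p := by
    intro S c
    calc _ = ∫ ω in S, ((c + 1) + stoppedSum alg l n ω) ∂p := by
          rw [integral_add (integrable_const _) hint.restrict]
          simp
      _ ≤ ∫ ω in S, Real.exp c * Z ω ∂p :=
          integral_mono ((integrable_const _).add hint.restrict) (hZint.restrict.const_mul _)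
            fun ω => by
              simp only [hZ, ← Real.exp_add]
              linarith [Real.add_one_le_exp (c + stoppedSum alg l n ω)]
      _ = _ := integral_const_mul _ _
  have h1 := hexp B u
  have h2 := hexp Bᶜ w
  have h3 := integral_add_compl hB hint
  have h4 : p.real Bᶜ = 1 - p.real B := probReal_compl_eq_one_sub hB
  rw [hZB] at h1
  rw [hZBc, h4] at h2
  linarith

/-! ### Wald's identity -/

/-- A function of the current round that is centred under the reward law of every arm stays centred
when restricted to an event of the past. -/
lemma integral_indicator_round_eq_zero (alg : Strategy K) (ν : Instance K)
    {f : Fin K × ℝ → ℝ} (hf : Measurable f) (hint : ∀ b, Integrable (fun x => f (b, x)) (ν.law b))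
    (hzero : ∀ b, ∫ x, f (b, x) ∂(ν.law b) = 0)
    {t : ℕ} {A : Set (Path K)} (hA : MeasurableSet[historyFiltration K t] A) :
    Integrable (A.indicator fun ω => f (ω t)) (pathMeasure alg ν) ∧
      ∫ ω, A.indicator (fun ω => f (ω t)) ω ∂(pathMeasure alg ν) = 0 := by
  set p := pathMeasure alg ν
  have hA' := measurableSet_of_history hA
  obtain ⟨B, hB, rfl⟩ := measurableSet_historyFiltration_iff.1 hA
  set C : ℝ≥0∞ := ∑ b, ∫⁻ x, ‖f (b, x)‖ₑ ∂(ν.law b)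
  have hCtop : C < ∞ := ENNReal.sum_lt_top.2 fun b _ => (hint b).hasFiniteIntegral
  have hround : ∀ v, ∫⁻ y, ‖f y‖ₑ ∂(roundKernel alg ν t v) ≤ C := by
    intro v
    rw [lintegral_roundKernel _ _ _ _ (by fun_prop)]
    calc _ ≤ ∫⁻ _, C ∂(actionKernel alg t v) := lintegral_mono fun b =>
            Finset.single_le_sum (f := fun b => ∫⁻ x, ‖f (b, x)‖ₑ ∂(ν.law b))
              (fun _ _ => zero_le) (Finset.mem_univ b)
      _ = C := by simp
  have hround_int : ∀ v, Integrable f (roundKernel alg ν t v) := fun v =>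
    ⟨hf.aestronglyMeasurable, (hround v).trans_lt hCtop⟩
  have hround_zero : ∀ v, ∫ y, f y ∂(roundKernel alg ν t v) = 0 := by
    intro v
    rw [roundKernel, ProbabilityTheory.integral_compProd (hround_int v)]
    have h : ∀ b, ∫ x, f (b, x) ∂(ν.rewardKernel b) = 0 := hzero
    simp [h]
  have hfint : Integrable (fun ω : Path K => f (ω t)) p := by
    refine ⟨(hf.comp (measurable_pi_apply t)).aestronglyMeasurable, ?_⟩
    have h := lintegral_history_prod alg ν t (f := fun z => ‖f z.2‖ₑ) (by fun_prop)
    simp only at h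
    rw [HasFiniteIntegral, h]
    calc _ ≤ ∫⁻ _, C ∂p := lintegral_mono fun ω => hround _
      _ < ∞ := by simpa using hCtop
  have hind := hfint.indicator hA'
  refine ⟨hind, ?_⟩
  set g : (Fin t → Fin K × ℝ) × (Fin K × ℝ) → ℝ := fun z => B.indicator 1 z.1 * f z.2 with hg
  have hgm : Measurable g :=
    ((measurable_one.indicator hB).comp measurable_fst).mul (hf.comp measurable_snd)
  have hgeq : ∀ ω : Path K, (history t ⁻¹' B).indicator (fun ω => f (ω t)) ω =
      g (history t ω, ω t) := by
    intro ω
    by_cases hω : history t ω ∈ B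
    · simp [hg, hω]
    · simp [hg, hω]
  have hmeas : Measurable (fun ω : Path K => (history t ω, ω t)) := by fun_prop
  have hgint : Integrable g (p.map (history t) ⊗ₘ roundKernel alg ν t) := by
    rw [← pathMeasure_map_history_prod, integrable_map_measure hgm.aestronglyMeasurable
      hmeas.aemeasurable]
    exact hind.congr (ae_of_all _ hgeq)
  simp only [hgeq]
  rw [← integral_map hmeas.aemeasurable hgm.aestronglyMeasurable, pathMeasure_map_history_prod,
    Measure.integral_compProd hgint]
  simp [hg, integral_const_mul, hround_zero]

/-- The expected number of pulls of arm `a` in the rounds `1, …, min n τ`; the index `i` is that of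
round `i + 1`. -/
noncomputable def expectedArmPulls (alg : Strategy K) (ν : Instance K) (n : ℕ) (a : Fin K) : ℝ :=
  ∑ i ∈ Finset.range n, (pathMeasure alg ν).real {ω | (i : ℕ∞) < alg.τ ω ∧ (ω i).1 = a}

/-- The log-density of `N(m + d, 1)` with respect to `N(m, 1)` at the reward of arm `a`, and zero at
the other arms. -/
noncomputable def shiftLogRatio (a : Fin K) (m d : ℝ) (y : Fin K × ℝ) : ℝ :=
  if y.1 = a then d * (y.2 - m) - d ^ 2 / 2 else 0

@[fun_prop]
lemma measurable_shiftLogRatio (a : Fin K) (m d : ℝ) : Measurable (shiftLogRatio a m d) := by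
  unfold shiftLogRatio
  exact Measurable.ite (measurable_fst (measurableSet_singleton a)) (by fun_prop) (by fun_prop)

lemma gaussianReal_add_eq_withDensity (m d : ℝ) :
    gaussianReal (m + d) 1 = (gaussianReal m 1).withDensity
      (fun x => ENNReal.ofReal (Real.exp (d * (x - m) - d ^ 2 / 2))) := by
  rw [gaussianReal_of_var_ne_zero _ one_ne_zero, gaussianReal_of_var_ne_zero _ one_ne_zero,
    ← withDensity_mul _ (measurable_gaussianPDF _ _) (by fun_prop)]
  congr 1
  ext x
  rw [Pi.mul_apply, gaussianPDF, gaussianPDF, ← ENNReal.ofReal_mul (gaussianPDFReal_nonneg _ _ _),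
    gaussianPDFReal, gaussianPDFReal, mul_assoc _ (Real.exp _), ← Real.exp_add]
  congr 3
  simp only [NNReal.coe_one]
  ring

lemma gaussianInstance_update_law (μ : Fin K → ℝ) (a : Fin K) (d : ℝ) (b : Fin K) :
    (gaussianInstance (Function.update μ a (μ a + d))).law b =
      ((gaussianInstance μ).law b).withDensity
        (fun x => ENNReal.ofReal (Real.exp (shiftLogRatio a (μ a) d (b, x)))) := by
  by_cases h : b = a
  · subst h
    simpa [gaussianInstance, shiftLogRatio] using gaussianReal_add_eq_withDensity (μ b) d
  · simp [gaussianInstance, shiftLogRatio, h]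

@[simp]
lemma gaussianInstance_mean (μ : Fin K → ℝ) (a : Fin K) : (gaussianInstance μ).mean a = μ a :=
  integral_id_gaussianReal

/-- Wald's identity: `d ^ 2 / 2` is the divergence per pull of arm `a`. -/
lemma integral_stoppedSum_shiftLogRatio (alg : Strategy K) (μ : Fin K → ℝ) (a : Fin K) (d : ℝ)
    (n : ℕ) :
    Integrable (stoppedSum alg (shiftLogRatio a (μ a) d) n)
        (pathMeasure alg (gaussianInstance μ)) ∧
      ∫ ω, stoppedSum alg (shiftLogRatio a (μ a) d) n ω ∂(pathMeasure alg (gaussianInstance μ)) =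
        -(d ^ 2 / 2 * expectedArmPulls alg (gaussianInstance μ) n a) := by
  set p := pathMeasure alg (gaussianInstance μ)
  have hm : ∀ i : ℕ, MeasurableSet {ω : Path K | (i : ℕ∞) < alg.τ ω ∧ (ω i).1 = a} := fun i =>
    (measurableSet_of_history (alg.measurableSet_lt_τ i)).inter
      (((measurable_pi_apply i).fst) (measurableSet_singleton a))
  set f : Fin K × ℝ → ℝ := fun y => if y.1 = a then y.2 - μ a else 0 with hf
  have hfm : Measurable f :=
    Measurable.ite (measurable_fst (measurableSet_singleton a)) (by fun_prop) (by fun_prop)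
  have hcentred : ∀ b, Integrable (fun x => f (b, x)) ((gaussianInstance μ).law b) ∧
      ∫ x, f (b, x) ∂((gaussianInstance μ).law b) = 0 := by
    intro b
    by_cases h : b = a
    · subst h
      have hi : Integrable (fun x : ℝ => x) (gaussianReal (μ b) 1) :=
        (memLp_id_gaussianReal 1).integrable le_rfl
      simp only [hf, if_true, gaussianInstance]
      refine ⟨hi.sub (integrable_const _), ?_⟩
      rw [integral_sub hi (integrable_const _), integral_id_gaussianReal]
      simp
    · simp [hf, h]
  have hstep := fun i : ℕ => integral_indicator_round_eq_zero alg (gaussianInstance μ) hfm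
    (fun b => (hcentred b).1) (fun b => (hcentred b).2) (alg.measurableSet_lt_τ i)
  have heq : ∀ (i : ℕ) (ω : Path K),
      {ω | (i : ℕ∞) < alg.τ ω}.indicator (fun ω => shiftLogRatio a (μ a) d (ω i)) ω =
        d * {ω | (i : ℕ∞) < alg.τ ω}.indicator (fun ω => f (ω i)) ω -
          d ^ 2 / 2 * {ω | (i : ℕ∞) < alg.τ ω ∧ (ω i).1 = a}.indicator 1 ω := by
    intro i ω
    by_cases h1 : (i : ℕ∞) < alg.τ ω <;> by_cases h2 : (ω i).1 = a <;>
      simp [Set.indicator, shiftLogRatio, hf, h1, h2]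
  have hi1 := fun i => (hstep i).1.const_mul d
  have hi2 : ∀ i : ℕ, Integrable (fun ω : Path K =>
      d ^ 2 / 2 * {ω | (i : ℕ∞) < alg.τ ω ∧ (ω i).1 = a}.indicator (1 : Path K → ℝ) ω) p := fun i =>
    ((integrable_const (1 : ℝ)).indicator (hm i)).const_mul _
  unfold stoppedSum
  simp only [heq]
  refine ⟨integrable_finsetSum _ fun i _ => (hi1 i).sub (hi2 i), ?_⟩
  rw [integral_finsetSum (f := fun (i : ℕ) (ω : Path K) => _ - _) _
    fun i _ => (hi1 i).sub (hi2 i), expectedArmPulls, Finset.mul_sum, ← Finset.sum_neg_distrib]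
  refine Finset.sum_congr rfl fun i _ => ?_
  rw [integral_sub (hi1 i) (hi2 i), integral_const_mul, integral_const_mul, (hstep i).2,
    integral_indicator_one (hm i)]
  ring

/-! ### The lower bound for a single arm -/

lemma Strategy.measurableSet_answer_inter_le (alg : Strategy K) (o : Option (Fin K)) (n : ℕ) :
    MeasurableSet ({ω | alg.answer ω = o} ∩ {ω | alg.τ ω ≤ n}) :=
  measurableSet_of_history (alg.measurableSet_inter_le (alg.measurable_answer o) n)

/-- On a negative instance, a `δ`-PAC algorithm has answered `none` by some finite time with
probability larger than `1 - δ`. -/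
lemma IsDeltaPAC.exists_lt_real_answer_none {μ₀ δ : ℝ} {alg : Strategy K}
    (hPAC : IsDeltaPAC μ₀ δ alg) {ν : Instance K} (hν : ν.IsNegative μ₀) :
    ∃ n : ℕ, 1 - δ <
      (pathMeasure alg ν).real ({ω | alg.answer ω = none} ∩ {ω | alg.τ ω ≤ n}) := by
  set p := pathMeasure alg ν
  have hmono : Monotone fun n : ℕ => {ω | alg.answer ω = none} ∩ {ω | alg.τ ω ≤ n} :=
    fun m n hmn => Set.inter_subset_inter_right _ fun ω hω =>
      le_trans (α := ℕ∞) hω (by exact_mod_cast hmn)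
  have hlim := (ENNReal.tendsto_toReal (measure_ne_top p _)).comp
    (tendsto_measure_iUnion_atTop (μ := p) hmono)
  refine (hlim.eventually (lt_mem_nhds ?_)).exists
  refine (hPAC ν (Or.inr hν)).trans_le (measureReal_mono ?_)
  rintro ω ⟨hτ, hans⟩
  obtain ⟨⟨b, hb⟩, -⟩ | ⟨-, hnone⟩ := hans
  · exact absurd (hν b) (not_lt.2 hb.le)
  · obtain ⟨n, hn⟩ := ENat.ne_top_iff_exists.1 hτ.ne
    exact Set.mem_iUnion.2 ⟨n, hnone, hn.symm.le⟩

/-- On a positive instance, a `δ`-PAC algorithm stops by time `n` with answer `none` with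
probability at most `δ`. -/
lemma IsDeltaPAC.real_answer_none_le {μ₀ δ : ℝ} {alg : Strategy K}
    (hPAC : IsDeltaPAC μ₀ δ alg) {ν : Instance K} (hν : ν.IsPositive μ₀) (n : ℕ) :
    (pathMeasure alg ν).real ({ω | alg.answer ω = none} ∩ {ω | alg.τ ω ≤ n}) ≤ δ := by
  have h := hPAC ν (Or.inl hν)
  have hsub : {ω | alg.τ ω < ⊤ ∧ alg.answer ω ∈ ν.correctAnswers μ₀} ⊆
      ({ω | alg.answer ω = none} ∩ {ω | alg.τ ω ≤ n})ᶜ := by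
    rintro ω ⟨-, hans⟩ ⟨hnone, -⟩
    obtain ⟨-, b, hb, -⟩ | ⟨hneg, -⟩ := hans
    · exact Option.some_ne_none b (hb.symm.trans hnone)
    · obtain ⟨b, hb⟩ := hν
      exact lt_asymm hb (hneg b)
  have h1 := measureReal_mono (μ := pathMeasure alg ν) hsub
  rw [probReal_compl_eq_one_sub (alg.measurableSet_answer_inter_le none n)] at h1
  linarith

/-- Comparison of `μ` with the instance in which arm `a` is moved from `μ₀ - Δ` to `μ₀ + Δ`,
where `Δ` is its gap. The left-hand side is the binary relative entropy of `1 - δ` and `δ`. -/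
lemma IsDeltaPAC.le_expectedArmPulls {μ₀ δ : ℝ} {alg : Strategy K}
    (hPAC : IsDeltaPAC μ₀ δ alg) (hδ : 0 < δ) (hδ' : δ < 1 / 2) {μ : Fin K → ℝ} {a : Fin K}
    (ha : μ a < μ₀) {n : ℕ}
    (hn : 1 - δ < (pathMeasure alg (gaussianInstance μ)).real
      ({ω | alg.answer ω = none} ∩ {ω | alg.τ ω ≤ n})) :
    (1 - 2 * δ) * Real.log ((1 - δ) / δ) ≤
      2 * (μ₀ - μ a) ^ 2 * expectedArmPulls alg (gaussianInstance μ) n a := by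
  set d := 2 * (μ₀ - μ a) with hd
  obtain ⟨hint, hval⟩ := integral_stoppedSum_shiftLogRatio alg μ a d n
  have hpos : (gaussianInstance (Function.update μ a (μ a + d))).IsPositive μ₀ := by
    refine ⟨a, ?_⟩
    rw [gaussianInstance_mean, Function.update_self]
    linarith
  have hq := hPAC.real_answer_none_le hpos n
  have hratio : 0 < (1 - δ) / δ := div_pos (by linarith) hδ
  -- The values `± log ((1 - δ) / δ)` are optimal when the two probabilities are `1 - δ` and `δ`.
  have h := add_integral_stoppedSum_le alg (measurable_shiftLogRatio a (μ a) d)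
    (gaussianInstance_update_law μ a d) (alg.measurable_answer none) n hint
    (Real.log ((1 - δ) / δ)) (-Real.log ((1 - δ) / δ))
  rw [hval, Real.exp_neg, Real.exp_log hratio, inv_div] at h
  set x := (pathMeasure alg (gaussianInstance μ)).real
    ({ω | alg.answer ω = none} ∩ {ω | alg.τ ω ≤ n})
  set z := (pathMeasure alg (gaussianInstance (Function.update μ a (μ a + d)))).real
    ({ω | alg.answer ω = none} ∩ {ω | alg.τ ω ≤ n})
  have hlog : 0 ≤ Real.log ((1 - δ) / δ) :=
    Real.log_nonneg ((one_le_div hδ).2 (by linarith))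
  have hcmp : δ / (1 - δ) ≤ (1 - δ) / δ :=
    ((div_le_one (by linarith)).2 (by linarith)).trans ((one_le_div hδ).2 (by linarith))
  have hsum : δ * ((1 - δ) / δ) + (1 - δ) * (δ / (1 - δ)) = 1 := by
    have h1 : 1 - δ ≠ 0 := by linarith
    field_simp
    ring
  have h1 := mul_le_mul_of_nonneg_right hq (sub_nonneg.2 hcmp)
  have h2 := mul_le_mul_of_nonneg_right hn.le hlog
  have h3 : d ^ 2 / 2 = 2 * (μ₀ - μ a) ^ 2 := by
    rw [hd]
    ring
  rw [h3] at h
  linarith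

/-! ### Summation over the arms -/

lemma sum_expectedArmPulls_le (alg : Strategy K) (ν : Instance K) (n : ℕ) :
    ENNReal.ofReal (∑ a, expectedArmPulls alg ν n a) ≤ expectedPulls alg ν := by
  set p := pathMeasure alg ν
  have hm : ∀ i : ℕ, MeasurableSet {ω : Path K | (i : ℕ∞) < alg.τ ω} := fun i =>
    measurableSet_of_history (alg.measurableSet_lt_τ i)
  have hsplit : ∀ i : ℕ, ∑ a, p.real {ω | (i : ℕ∞) < alg.τ ω ∧ (ω i).1 = a} =
      p.real {ω | (i : ℕ∞) < alg.τ ω} := by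
    intro i
    have hma : ∀ a, MeasurableSet ((fun ω : Path K => (ω i).1) ⁻¹' {a}) := fun a =>
      ((measurable_pi_apply i).fst) (measurableSet_singleton a)
    rw [← measureReal_biUnion_finset]
    · congr 1
      ext ω
      simp
    · intro a _ b _ hab
      exact Set.disjoint_left.2 fun ω h1 h2 => hab (h1.2.symm.trans h2.2)
    · exact fun a _ => (hm i).inter (hma a)
  have hsum : ∑ a, expectedArmPulls alg ν n a =
      ∑ i ∈ Finset.range n, p.real {ω | (i : ℕ∞) < alg.τ ω} := by
    unfold expectedArmPulls
    rw [Finset.sum_comm]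
    exact Finset.sum_congr rfl fun i _ => hsplit i
  rw [hsum, ENNReal.ofReal_sum_of_nonneg fun _ _ => measureReal_nonneg]
  have hind : ∀ i : ℕ, ENNReal.ofReal (p.real {ω | (i : ℕ∞) < alg.τ ω}) =
      ∫⁻ ω, {ω | (i : ℕ∞) < alg.τ ω}.indicator 1 ω ∂p := fun i => by
    rw [lintegral_indicator_one (hm i), ofReal_measureReal]
  simp only [hind]
  rw [← lintegral_finsetSum _ fun i _ => measurable_one.indicator (hm i)]
  refine lintegral_mono fun ω => ?_
  -- `min n τ` counts the `i < n` with `i < τ`.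
  have hcount : ∀ n : ℕ, ∑ i ∈ Finset.range n,
      {ω | (i : ℕ∞) < alg.τ ω}.indicator (1 : Path K → ℝ≥0∞) ω =
        ((min (n : ℕ∞) (alg.τ ω) : ℕ∞) : ℝ≥0∞) := by
    intro n
    induction n with
    | zero => simp
    | succ n ih =>
      rw [Finset.sum_range_succ, ih]
      by_cases h : (n : ℕ∞) < alg.τ ω
      · have h' : ((n + 1 : ℕ) : ℕ∞) ≤ alg.τ ω := by
          push_cast
          exact Order.add_one_le_of_lt h
        rw [min_eq_left h.le, min_eq_left h']
        simp [Set.indicator, h]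
      · have h' : alg.τ ω ≤ n := not_lt.1 h
        rw [min_eq_right h', min_eq_right (h'.trans (by exact_mod_cast n.le_succ))]
        simp [Set.indicator, h]
  rw [hcount n]
  exact ENat.toENNReal_le.2 (min_le_right _ _)

/-- Up to a factor depending on `δ₀` only, the binary relative entropy of `1 - δ` and `δ` is at
least `log (1 / δ)`. -/
lemma mul_log_one_div_le {δ₀ δ : ℝ} (hδ₀' : δ₀ < 1 / 2) (hδ : 0 < δ) (hle : δ ≤ δ₀) :
    (1 - 2 * δ₀) * (1 - Real.log (1 - δ₀) / Real.log δ₀) * Real.log (1 / δ) ≤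
      (1 - 2 * δ) * Real.log ((1 - δ) / δ) := by
  have hδ₀ : 0 < δ₀ := hδ.trans_le hle
  have hlog₀ : Real.log δ₀ < 0 := Real.log_neg hδ₀ (by linarith)
  have h1 : Real.log (1 - δ₀) ≤ Real.log (1 - δ) := Real.log_le_log (by linarith) (by linarith)
  have h2 : Real.log δ ≤ Real.log δ₀ := Real.log_le_log hδ hle
  have h3 : Real.log (1 - δ₀) < 0 := Real.log_neg (by linarith) (by linarith)
  have hc : 0 ≤ Real.log (1 - δ₀) / Real.log δ₀ := div_nonneg_of_nonpos h3.le hlog₀.le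
  have h4 : Real.log (1 - δ₀) / Real.log δ₀ * Real.log δ ≤ Real.log (1 - δ₀) :=
    (mul_le_mul_of_nonneg_left h2 hc).trans_eq (div_mul_cancel₀ _ hlog₀.ne)
  have h5 : 0 ≤ Real.log ((1 - δ) / δ) := Real.log_nonneg ((one_le_div hδ).2 (by linarith))
  have h6 : (1 - Real.log (1 - δ₀) / Real.log δ₀) * Real.log (1 / δ) ≤
      Real.log ((1 - δ) / δ) := by
    rw [one_div, Real.log_inv, Real.log_div (by linarith) hδ.ne']
    linarith
  rw [mul_assoc]
  calc _ ≤ (1 - 2 * δ₀) * Real.log ((1 - δ) / δ) :=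
        mul_le_mul_of_nonneg_left h6 (by linarith)
    _ ≤ _ := mul_le_mul_of_nonneg_right (by linarith) h5

end OneIdentification

theorem mainTheorem3 (δ₀ : ℝ) (hδ₀ : 0 < δ₀) (hδ₀' : δ₀ < 1 / 2) :
    ∃ c : ℝ, 0 < c ∧
      ∀ (K : ℕ) (μ₀ : ℝ) (μ : Fin K → ℝ), (∀ a, μ a < μ₀) →
        ∀ δ : ℝ, 0 < δ → δ ≤ δ₀ →
          ∀ alg : OneIdentification.Strategy K, OneIdentification.IsDeltaPAC μ₀ δ alg →
            ENNReal.ofReal (c * OneIdentification.H1neg μ₀ μ * Real.log (1 / δ)) ≤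
              OneIdentification.expectedPulls alg (OneIdentification.gaussianInstance μ) := by
  have hlog₀ : Real.log δ₀ < 0 := Real.log_neg hδ₀ (by linarith)
  have hlt : Real.log (1 - δ₀) / Real.log δ₀ < 1 :=
    (div_lt_one_of_neg hlog₀).2 (Real.log_lt_log hδ₀ (by linarith))
  refine ⟨(1 - 2 * δ₀) * (1 - Real.log (1 - δ₀) / Real.log δ₀) / 4,
    div_pos (mul_pos (by linarith) (by linarith)) (by norm_num), ?_⟩
  intro K μ₀ μ hμ δ hδ hle alg hPAC
  have hneg : (OneIdentification.gaussianInstance μ).IsNegative μ₀ := fun a => by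
    rw [OneIdentification.gaussianInstance_mean]
    exact hμ a
  obtain ⟨n, hn⟩ := hPAC.exists_lt_real_answer_none hneg
  refine le_trans (ENNReal.ofReal_le_ofReal ?_)
    (OneIdentification.sum_expectedArmPulls_le alg (OneIdentification.gaussianInstance μ) n)
  rw [OneIdentification.H1neg, Finset.mul_sum, Finset.sum_mul]
  refine Finset.sum_le_sum fun a _ => ?_
  have h := (OneIdentification.mul_log_one_div_le hδ₀' hδ hle).trans
    (hPAC.le_expectedArmPulls hδ (hle.trans_lt hδ₀') (hμ a) hn)
  have hΔ : 0 < (μ₀ - μ a) ^ 2 := pow_pos (sub_pos.2 (hμ a)) 2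
  rw [sq_abs, div_mul_div_comm, div_mul_eq_mul_div, div_le_iff₀ (by linarith)]
  linarith
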